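/- Let $\mathcal L_A$ be the first-order language (with equality) of signature $\langle 0,1,+,\times,<\rangle$. All theories are formulated in languages extending $\mathcal L_A$ by finitely many relation symbols, taken from a fixed supply with countably many symbols of each arity; $\mathcal L_\alpha$ denotes $\mathcal L_A$ together with the non-arithmetic symbols occurring in the sentence $\alpha$, and $T\vdash\varphi$ means that $\varphi$ is provable from $T$ in first-order logic (equivalently, $\varphi$ is a logical consequence of $T$). Let $\mathrm{EA}$ be the theory of nonnegative parts of discretely ordered rings, together with induction (with parameters) for $\Delta_0$ formulae of $\mathcal L_A$ and the axiom $\forall x\forall y\exists z\; x^y=z$, with exponentiation expressed by an arithmetical formula. A sentence $\alpha$ is a *definition of truth* if it is consistent, $\alpha\vdash\mathrm{EA}$, and there is a formula $\Theta(x)$ of $\mathcal L_\alpha$ with one free variable such that $\alpha\vdash\Theta(\ulcorner\sigma\urcorner)\leftrightarrow\sigma$ for every sentence $\sigma$ of $\mathcal L_A$. Let $\mathrm{cDEF}$ be the set of definitions of truth $\alpha$ that are conservative over $\mathrm{EA}$, i.e. every $\mathcal L_A$-sentence provable from $\alpha$ is provable in $\mathrm{EA}$. For $\alpha,\beta\in\mathrm{cDEF}$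 write $\alpha\lhd\beta$ if $\alpha$ is definable in $\beta$: there is a translation $\tau$ that leaves the arithmetical symbols unchanged and assigns to each non-arithmetic $n$-ary relation symbol of $\mathcal L_\alpha$ a formula of $\mathcal L_\beta$ in $n$ free variables, such that $\beta\vdash\tau[\alpha]$. The relation $\lhd$ is a preorder; the *definability order* is the partial order that it induces on the set of classes $[\alpha]$ of $\alpha\in\mathrm{cDEF}$ modulo mutual definability. **Theorem.** The definability order is a distributive lattice. Its operations are given as follows, for $\alpha,\beta\in\mathrm{cDEF}$. 1. $\alpha\lor\beta\in\mathrm{cDEF}$, and the infimum of $[\alpha]$ and $[\beta]$ is $[\alpha\lor\beta]$. 2. Let $\mathrm{rep}_\alpha$ be a translation that replaces the non-arithmetic relation symbols of $\beta$, injectively, by symbols of the same arity that do not occur in $\alpha$ (for each $\alpha$ there is one such translation that works for all $\beta$). Then $\alpha\land\mathrm{rep}_\alpha(\beta)\in\mathrm{cDEF}$, and the supremum of $[\alpha]$ and $[\beta]$ is $[\alpha\land\mathrm{rep}_\alpha(\beta)]$. -/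

import Mathlib

open FirstOrder FirstOrder.Language

namespace TruthDef

/-! ### Languages -/

/-- Function symbols of the language of arithmetic. -/
inductive ArithFunc : ℕ → Type
  | zero : ArithFunc 0
  | one : ArithFunc 0
  | add : ArithFunc 2
  | mul : ArithFunc 2

/-- Relation symbols of the language of arithmetic (besides equality). -/
inductive ArithRel : ℕ → Type
  | lt : ArithRel 2

/-- The language of arithmetic, with signature `0, 1, +, ×, <`. -/
abbrev arith : Language := ⟨ArithFunc, ArithRel⟩

/-- The supply of non-arithmetic relation symbols: for every arity `n` there is one `n`-ary
symbol for each natural number. -/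
abbrev predPool : Language := ⟨fun _ => Empty, fun _ => ℕ⟩

/-- The language of arithmetic together with all non-arithmetic relation symbols. Every language
that extends the language of arithmetic by finitely many relation symbols is a part of it. -/
abbrev full : Language := arith.sum predPool

/-- An arithmetical sentence regarded as a sentence of the full language. -/
def ofArith (φ : arith.Sentence) : full.Sentence :=
  (LHom.sumInl : arith →ᴸ full).onSentence φ

/-- The non-arithmetic relation symbols, given as pairs (arity, index), that occur in a formula. -/
def symbols {α : Type} : ∀ {n : ℕ}, full.BoundedFormula α n → Finset (ℕ × ℕ)
  | _, .falsum => ∅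
  | _, .equal _ _ => ∅
  | _, .rel (.inl _) _ => ∅
  | _, .rel (l := l) (.inr k) _ => {(l, k)}
  | _, .imp φ ψ => symbols φ ∪ symbols ψ
  | _, .all φ => symbols φ

/-- The non-arithmetic part of the signature of a theory. -/
def signature (T : full.Theory) : Set (ℕ × ℕ) :=
  {P | ∃ φ ∈ T, P ∈ symbols φ}

/-- `inst φ t` is the formula `φ(t₁, …, tₖ)`, with bound variables renamed if necessary. -/
def inst {L : FirstOrder.Language.{0, 0}} {α : Type} {k n : ℕ} (φ : L.Formula (Fin k))
    (t : Fin k → L.Term (α ⊕ Fin n)) : L.BoundedFormula α n :=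
  (φ.subst t).relabel id

/-! ### Elementary arithmetic -/

section Arithmetic

variable {α : Type} {n : ℕ}

def tZero : arith.Term α := Term.func ArithFunc.zero ![]

def tOne : arith.Term α := Term.func ArithFunc.one ![]

def tAdd (s t : arith.Term α) : arith.Term α := Term.func ArithFunc.add ![s, t]

def tMul (s t : arith.Term α) : arith.Term α := Term.func ArithFunc.mul ![s, t]

def fLt (s t : arith.Term (α ⊕ Fin n)) : arith.BoundedFormula α n :=
  BoundedFormula.rel ArithRel.lt ![s, t]

def fEq (s t : arith.Term (α ⊕ Fin n)) : arith.BoundedFormula α n :=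
  BoundedFormula.equal s t

/-- The `i`-th bound variable. -/
def tVar (i : Fin n) : arith.Term (α ⊕ Fin n) := Term.var (Sum.inr i)

/-- A term, used under one more quantifier (which does not bind any of its variables). -/
def tLift (t : arith.Term (α ⊕ Fin n)) : arith.Term (α ⊕ Fin (n + 1)) :=
  t.relabel (Sum.map id Fin.castSucc)

/-- `∀ x < t, φ`. -/
def ballLt (t : arith.Term (α ⊕ Fin n)) (φ : arith.BoundedFormula α (n + 1)) :
    arith.BoundedFormula α n :=
  ((fLt (tVar (Fin.last n)) (tLift t)).imp φ).all

/-- `∃ x < t, φ`. -/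
def bexLt (t : arith.Term (α ⊕ Fin n)) (φ : arith.BoundedFormula α (n + 1)) :
    arith.BoundedFormula α n :=
  (fLt (tVar (Fin.last n)) (tLift t) ⊓ φ).ex

/-- The bounded formulas of arithmetic. -/
inductive IsDelta0 : ∀ {n : ℕ}, arith.BoundedFormula α n → Prop
  | falsum {n : ℕ} : IsDelta0 (BoundedFormula.falsum : arith.BoundedFormula α n)
  | equal {n : ℕ} (s t : arith.Term (α ⊕ Fin n)) : IsDelta0 (BoundedFormula.equal s t)
  | rel {n l : ℕ} (R : arith.Relations l) (t : Fin l → arith.Term (α ⊕ Fin n)) :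
      IsDelta0 (BoundedFormula.rel R t)
  | imp {n : ℕ} {φ ψ : arith.BoundedFormula α n} :
      IsDelta0 φ → IsDelta0 ψ → IsDelta0 (φ.imp ψ)
  | ball {n : ℕ} (t : arith.Term (α ⊕ Fin n)) {φ : arith.BoundedFormula α (n + 1)} :
      IsDelta0 φ → IsDelta0 (ballLt t φ)
  | bex {n : ℕ} (t : arith.Term (α ⊕ Fin n)) {φ : arith.BoundedFormula α (n + 1)} :
      IsDelta0 φ → IsDelta0 (bexLt t φ)

end Arithmetic


/-- The axioms of nonnegative parts of discretely ordered rings. -/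
inductive PAMinus : arith.Theory
  | add_assoc : PAMinus (BoundedFormula.alls (n := 3)
      (fEq (tAdd (tAdd (tVar 0) (tVar 1)) (tVar 2)) (tAdd (tVar 0) (tAdd (tVar 1) (tVar 2)))))
  | add_comm : PAMinus (BoundedFormula.alls (n := 2) (fEq (tAdd (tVar 0) (tVar 1)) (tAdd (tVar 1) (tVar 0))))
  | mul_assoc : PAMinus (BoundedFormula.alls (n := 3)
      (fEq (tMul (tMul (tVar 0) (tVar 1)) (tVar 2)) (tMul (tVar 0) (tMul (tVar 1) (tVar 2)))))
  | mul_comm : PAMinus (BoundedFormula.alls (n := 2) (fEq (tMul (tVar 0) (tVar 1)) (tMul (tVar 1) (tVar 0))))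
  | mul_add : PAMinus (BoundedFormula.alls (n := 3)
      (fEq (tMul (tVar 0) (tAdd (tVar 1) (tVar 2)))
        (tAdd (tMul (tVar 0) (tVar 1)) (tMul (tVar 0) (tVar 2)))))
  | add_zero : PAMinus (BoundedFormula.alls (n := 1) (fEq (tAdd (tVar 0) tZero) (tVar 0)))
  | mul_zero : PAMinus (BoundedFormula.alls (n := 1) (fEq (tMul (tVar 0) tZero) tZero))
  | mul_one : PAMinus (BoundedFormula.alls (n := 1) (fEq (tMul (tVar 0) tOne) (tVar 0)))
  | lt_trans : PAMinus (BoundedFormula.alls (n := 3)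
      ((fLt (tVar 0) (tVar 1) ⊓ fLt (tVar 1) (tVar 2)).imp (fLt (tVar 0) (tVar 2))))
  | lt_irrefl : PAMinus (BoundedFormula.alls (n := 1) (fLt (tVar 0) (tVar 0)).not)
  | lt_total : PAMinus (BoundedFormula.alls (n := 2)
      (fLt (tVar 0) (tVar 1) ⊔ (fEq (tVar 0) (tVar 1) ⊔ fLt (tVar 1) (tVar 0))))
  | add_lt : PAMinus (BoundedFormula.alls (n := 3)
      ((fLt (tVar 0) (tVar 1)).imp (fLt (tAdd (tVar 0) (tVar 2)) (tAdd (tVar 1) (tVar 2)))))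
  | mul_lt : PAMinus (BoundedFormula.alls (n := 3)
      ((fLt tZero (tVar 2) ⊓ fLt (tVar 0) (tVar 1)).imp
        (fLt (tMul (tVar 0) (tVar 2)) (tMul (tVar 1) (tVar 2)))))
  | sub : PAMinus (BoundedFormula.alls (n := 2)
      ((fLt (tVar 0) (tVar 1)).imp (fEq (tAdd (tVar 0) (tVar 2)) (tVar 1)).ex))
  | zero_lt_one : PAMinus (fLt tZero tOne)
  | one_le : PAMinus (BoundedFormula.alls (n := 1)
      ((fLt tZero (tVar 0)).imp (fLt tOne (tVar 0) ⊔ fEq (tVar 0) tOne)))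
  | zero_le : PAMinus (BoundedFormula.alls (n := 1) (fLt tZero (tVar 0) ⊔ fEq (tVar 0) tZero))

/-- The induction axiom for `φ(p₁, …, pₙ, x)` with respect to `x`, with parameters `p₁, …, pₙ`:
`∀ p (φ(p, 0) ∧ ∀ x (φ(p, x) → φ(p, x + 1)) → ∀ x φ(p, x))`. -/
def inductionAxiom {n : ℕ} (φ : arith.Formula (Fin (n + 1))) : arith.Sentence :=
  BoundedFormula.alls (n := n)
    ((inst φ (Fin.snoc (fun i : Fin n => tVar i) tZero) ⊓
        ((inst φ (Fin.snoc (fun i : Fin n => tVar i.castSucc) (tVar (Fin.last n)))).imp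
          (inst φ (Fin.snoc (fun i : Fin n => tVar i.castSucc)
            (tAdd (tVar (Fin.last n)) tOne)))).all).imp
      (inst φ (Fin.snoc (fun i : Fin n => tVar i.castSucc) (tVar (Fin.last n)))).all)

/-- Gödel's beta function: `r` is the remainder of `a` on division by `1 + (i + 1) * b`. -/
def betaFormula {n : ℕ} (a b i r : arith.Term (Empty ⊕ Fin n)) : arith.BoundedFormula Empty n :=
  fLt r (tAdd tOne (tMul (tAdd i tOne) b)) ⊓
    (fEq (tLift a)
      (tAdd (tMul (tVar (Fin.last n)) (tLift (tAdd tOne (tMul (tAdd i tOne) b))))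
        (tLift r))).ex

/-- The formula `x ^ y = z` in the variables `x, y, z` (numbers 0, 1, 2), which says that there is
a sequence (coded by `a, b`, the variables 3 and 4) whose entry number 0 is `1`, whose entry number
`i + 1` is `x` times its entry number `i` for `i < y`, and whose entry number `y` is `z`. -/
def expFormula : arith.BoundedFormula Empty 3 :=
  BoundedFormula.ex (BoundedFormula.ex (n := 4)
    (betaFormula (tVar 3) (tVar 4) tZero tOne ⊓
      (ballLt (tVar 1) (BoundedFormula.ex (n := 6)
          (betaFormula (tVar 3) (tVar 4) (tVar 5) (tVar 6) ⊓
            betaFormula (tVar 3) (tVar 4) (tAdd (tVar 5) tOne) (tMul (tVar 6) (tVar 0)))) ⊓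
        betaFormula (tVar 3) (tVar 4) (tVar 1) (tVar 2))))

/-- Elementary arithmetic: the axioms of nonnegative parts of discretely ordered rings, induction
for bounded formulas, and the totality of exponentiation. -/
def EA : arith.Theory :=
  PAMinus ∪ {ψ | ∃ (n : ℕ) (φ : arith.Formula (Fin (n + 1))), IsDelta0 φ ∧ ψ = inductionAxiom φ} ∪
    {expFormula.ex.alls}

/-! ### Gödel numbers -/

def termCode {n : ℕ} : arith.Term (Empty ⊕ Fin n) → ℕ
  | .var (.inr i) => Nat.pair 0 i
  | .func ArithFunc.zero _ => Nat.pair 1 0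
  | .func ArithFunc.one _ => Nat.pair 2 0
  | .func ArithFunc.add t => Nat.pair 3 (Nat.pair (termCode (t 0)) (termCode (t 1)))
  | .func ArithFunc.mul t => Nat.pair 4 (Nat.pair (termCode (t 0)) (termCode (t 1)))

/-- The Gödel number of an arithmetical formula. -/
def code : ∀ {n : ℕ}, arith.BoundedFormula Empty n → ℕ
  | _, .falsum => Nat.pair 0 0
  | _, .equal s t => Nat.pair 1 (Nat.pair (termCode s) (termCode t))
  | _, .rel ArithRel.lt t => Nat.pair 2 (Nat.pair (termCode (t 0)) (termCode (t 1)))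
  | _, .imp φ ψ => Nat.pair 3 (Nat.pair (code φ) (code ψ))
  | _, .all φ => Nat.pair 4 (code φ)

/-- The numeral `0 + 1 + ⋯ + 1`. -/
def numeral {α : Type} : ℕ → arith.Term α
  | 0 => tZero
  | n + 1 => tAdd (numeral n) tOne

/-! ### Definitions of truth -/

/-- `T` is a theory of truth for the language of arithmetic: it is consistent, it contains `EA`,
and some formula `Θ` of its language with one free variable satisfies
`T ⊢ Θ(⌜σ⌝) ↔ σ` for all arithmetical sentences `σ`. -/
def IsTheoryOfTruth (T : full.Theory) : Prop :=
  T.IsSatisfiable ∧ (∀ φ ∈ EA, T ⊨ᵇ ofArith φ) ∧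
    ∃ Θ : full.Formula (Fin 1), (symbols Θ : Set (ℕ × ℕ)) ⊆ signature T ∧
      ∀ σ : arith.Sentence, T ⊨ᵇ BoundedFormula.iff (n := 0)
        (inst Θ fun _ => (LHom.sumInl : arith →ᴸ full).onTerm (numeral (code σ))) (ofArith σ)

/-- Every arithmetical sentence provable in `T` is provable in `EA`. -/
def IsConservativeOverEA (T : full.Theory) : Prop :=
  ∀ σ : arith.Sentence, T ⊨ᵇ ofArith σ → EA ⊨ᵇ σ

/-! ### Translations and definability -/

/-- An assignment of a formula in `n` variables to each non-arithmetic `n`-ary relation symbol. -/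
abbrev Translation : Type := ∀ n : ℕ, ℕ → full.Formula (Fin n)

/-- `s` translates the symbols of the signature `A` into formulas of the signature `B`. -/
def Translation.MapsTo (s : Translation) (A B : Set (ℕ × ℕ)) : Prop :=
  ∀ n k : ℕ, (n, k) ∈ A → (symbols (s n k) : Set (ℕ × ℕ)) ⊆ B

/-- The result of applying a translation to a formula; arithmetical symbols are not changed. -/
def Translation.apply {α : Type} (s : Translation) :
    ∀ {n : ℕ}, full.BoundedFormula α n → full.BoundedFormula α n
  | _, .falsum => .falsum
  | _, .equal t u => .equal t u
  | _, .rel (.inl R) t => .rel (.inl R) t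
  | _, .rel (l := l) (.inr k) t => inst (s l k) t
  | _, .imp φ ψ => (s.apply φ).imp (s.apply ψ)
  | _, .all φ => (s.apply φ).all

/-- `U` is definable in `V` (modulo the arithmetical signature). -/
def Definable (U V : full.Theory) : Prop :=
  ∃ s : Translation, s.MapsTo (signature U) (signature V) ∧
    ∀ φ ∈ U, V ⊨ᵇ (s.apply φ : full.Sentence)

/-- The translation that replaces the `n`-ary symbol number `k` by the `n`-ary symbol number
`ρ n k`. -/
def renameBy (ρ : ℕ → ℕ → ℕ) : Translation :=
  fun n k => Relations.formula (L := full) (n := n) (Sum.inr (ρ n k)) Term.var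

/-- `ρ` replaces distinct non-arithmetic symbols of `β` by distinct ones, none of which
occurs in `α`. -/
def RenamesApart (ρ : ℕ → ℕ → ℕ) (α β : full.Sentence) : Prop :=
  Set.InjOn (fun P : ℕ × ℕ => (P.1, ρ P.1 P.2)) (symbols β : Set (ℕ × ℕ)) ∧
    ∀ P ∈ symbols β, (P.1, ρ P.1 P.2) ∉ symbols α

/-! ### Definability is a preorder -/

theorem symbols_castLE {α : Type} {m n : ℕ} (h : m ≤ n) (φ : full.BoundedFormula α m) :
    symbols (φ.castLE h) = symbols φ := by
  induction φ generalizing n with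
  | falsum => rfl
  | equal => rfl
  | rel R t => cases R <;> rfl
  | imp _ _ ih1 ih2 => simp only [BoundedFormula.castLE, symbols, ih1, ih2]
  | all _ ih => simp only [BoundedFormula.castLE, symbols, ih]

theorem symbols_mapTermRel {α β : Type} {g : ℕ → ℕ}
    (ft : ∀ n, full.Term (α ⊕ (Fin n)) → full.Term (β ⊕ (Fin (g n))))
    (h : ∀ n, full.BoundedFormula β (g (n + 1)) → full.BoundedFormula β (g n + 1))
    (hh : ∀ n φ, symbols (h n φ) = symbols φ) {n : ℕ} (φ : full.BoundedFormula α n) :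
    symbols (φ.mapTermRel ft (fun _ => id) h) = symbols φ := by
  induction φ with
  | falsum => rfl
  | equal => rfl
  | rel R t => cases R <;> rfl
  | imp _ _ ih1 ih2 => simp only [BoundedFormula.mapTermRel, symbols, ih1, ih2]
  | all _ ih => simp only [BoundedFormula.mapTermRel, symbols, hh, ih]

theorem symbols_inst {α : Type} {k n : ℕ} (φ : full.Formula (Fin k))
    (t : Fin k → full.Term (α ⊕ Fin n)) : symbols (inst φ t) = symbols φ := by
  unfold inst BoundedFormula.relabel BoundedFormula.subst
  refine (symbols_mapTermRel _ _ (fun _ _ => symbols_castLE _ _) _).trans ?_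
  exact symbols_mapTermRel (g := id) _ _ (fun _ _ => rfl) _

theorem symbols_apply {α : Type} (s : Translation) {A B : Set (ℕ × ℕ)} (hs : s.MapsTo A B)
    {n : ℕ} (φ : full.BoundedFormula α n) (hφ : (symbols φ : Set (ℕ × ℕ)) ⊆ A) :
    (symbols (s.apply φ) : Set (ℕ × ℕ)) ⊆ B := by
  induction φ with
  | falsum => simp [Translation.apply, symbols]
  | equal => simp [Translation.apply, symbols]
  | rel R t =>
    cases R with
    | inl R => simp [Translation.apply, symbols]
    | inr k =>
      simp only [Translation.apply, symbols_inst]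
      exact hs _ _ (hφ (by simp [symbols]))
  | imp _ _ ih1 ih2 =>
    simp only [symbols, Finset.coe_union, Set.union_subset_iff] at hφ
    simp only [Translation.apply, symbols, Finset.coe_union, Set.union_subset_iff]
    exact ⟨ih1 hφ.1, ih2 hφ.2⟩
  | all _ ih => exact ih hφ

theorem realize_inst {L : FirstOrder.Language.{0, 0}} {M : Type*} [L.Structure M] {α : Type} {k n : ℕ}
    (φ : L.Formula (Fin k)) (t : Fin k → L.Term (α ⊕ Fin n)) (v : α → M) (xs : Fin n → M) :
    (inst φ t).Realize v xs ↔ φ.Realize fun i => (t i).realize (Sum.elim v xs) := by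
  unfold inst
  rw [BoundedFormula.realize_relabel, BoundedFormula.realize_subst]
  unfold Formula.Realize
  have : (Sum.elim v (xs ∘ Fin.castAdd 0) ∘ id : α ⊕ Fin n → M) = Sum.elim v xs := rfl
  rw [this]
  exact iff_of_eq (congrArg _ (Subsingleton.elim _ _))

/-- The structure in which the non-arithmetic relation symbols are interpreted by the formulas that
a translation assigns to them. -/
@[reducible] def reinterpret (s : Translation) {M : Type*} (S : full.Structure M) :
    full.Structure M where
  funMap := S.funMap
  RelMap {_} R v := match R with
    | .inl R => S.RelMap (.inl R) v
    | .inr k => @Formula.Realize full M S _ (s _ k) v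

theorem realize_term_reinterpret (s : Translation) {M α : Type*} (S : full.Structure M)
    (t : full.Term α) (v : α → M) :
    @Term.realize full M (reinterpret s S) α v t = @Term.realize full M S α v t := by
  induction t with
  | var => rfl
  | func f ts ih =>
    simp only [Term.realize]
    exact congrArg _ (funext ih)

theorem realize_apply (s : Translation) {M : Type*} {α : Type} (S : full.Structure M)
    {n : ℕ} (φ : full.BoundedFormula α n) (v : α → M) (xs : Fin n → M) :
    @BoundedFormula.Realize full M S _ _ (s.apply φ) v xs ↔
      @BoundedFormula.Realize full M (reinterpret s S) _ _ φ v xs := by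
  induction φ with
  | falsum => rfl
  | equal t u =>
    simp only [Translation.apply, BoundedFormula.Realize, realize_term_reinterpret]
  | rel R t =>
    cases R with
    | inl R =>
      simp only [Translation.apply, BoundedFormula.Realize, realize_term_reinterpret]
      exact Iff.rfl
    | inr k =>
      simp only [Translation.apply, BoundedFormula.Realize, realize_term_reinterpret, realize_inst]
      exact Iff.rfl
  | imp _ _ ih1 ih2 => simp only [Translation.apply, BoundedFormula.Realize, ih1, ih2]
  | all _ ih => simp only [Translation.apply, BoundedFormula.Realize, ih]

theorem reinterpret_renameBy_self {M : Type*} (S : full.Structure M) :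
    reinterpret (renameBy fun _ k => k) S = S := by
  refine Structure.ext rfl ?_
  funext n R v
  cases R with
  | inl R => rfl
  | inr k => exact propext (Formula.realize_rel (L := full) (R := Sum.inr k))

theorem symbols_renameBy (ρ : ℕ → ℕ → ℕ) (n k : ℕ) : symbols (renameBy ρ n k) = {(n, ρ n k)} :=
  rfl

theorem models_apply_iff (V : full.Theory) (s : Translation) (φ : full.Sentence) :
    V ⊨ᵇ (s.apply φ : full.Sentence) ↔
      ∀ M : Theory.ModelType.{0, 0, 0} V, @Sentence.Realize full M (reinterpret s M.struc) φ := by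
  rw [Theory.models_sentence_iff]
  exact forall_congr' fun M => realize_apply s M.struc φ _ _

theorem Definable.refl (U : full.Theory) : Definable U U := by
  refine ⟨renameBy fun _ k => k, fun n k h => ?_, fun φ hφ => ?_⟩
  · rw [symbols_renameBy]
    simpa using h
  · rw [models_apply_iff]
    intro M
    rw [reinterpret_renameBy_self]
    exact Theory.realize_sentence_of_mem U hφ

theorem Definable.trans {U V W : full.Theory} (h₁ : Definable U V) (h₂ : Definable V W) :
    Definable U W := by
  obtain ⟨s, hs, hsU⟩ := h₁
  obtain ⟨r, hr, hrV⟩ := h₂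
  refine ⟨fun n k => r.apply (s n k), fun n k h => symbols_apply r hr _ (hs n k h), ?_⟩
  intro φ hφ
  rw [models_apply_iff]
  intro M
  have key : reinterpret (fun n k => r.apply (s n k)) M.struc =
      reinterpret s (reinterpret r M.struc) := by
    refine Structure.ext rfl ?_
    funext n R v
    cases R with
    | inl R => rfl
    | inr k => exact propext (realize_apply r M.struc (s n k) v _)
  rw [key]
  have hV : @Theory.Model full M (reinterpret r M.struc) V :=
    @Theory.Model.mk full M (reinterpret r M.struc) V fun ψ hψ =>
      (models_apply_iff W r ψ).1 (hrV ψ hψ) M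
  exact (models_apply_iff V s φ).1 (hsU φ hφ)
    (@Theory.ModelType.mk full V M (reinterpret r M.struc) hV inferInstance)

/-! ### The definability order -/

/-- A definition of truth that is a conservative extension of `EA`. A finitely axiomatizable theory
is given by a single sentence that axiomatizes it. -/
def IsConservativeTruthDefinition (α : full.Sentence) : Prop :=
  IsTheoryOfTruth {α} ∧ IsConservativeOverEA {α}

/-- The type of definitions of truth that are conservative extensions of `EA`. -/
def CDef : Type := {α : full.Sentence // IsConservativeTruthDefinition α}

/-- `α ≤ β` means that `α` is definable in `β`. -/
instance : Preorder CDef where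
  le α β := Definable {α.1} {β.1}
  le_refl α := Definable.refl {α.1}
  le_trans _ _ _ h₁ h₂ := Definable.trans h₁ h₂

/-- The definability order: the partial order of conservative definitions of truth modulo mutual
definability. -/
abbrev DefinabilityOrder : Type := Antisymmetrization CDef (· ≤ ·)

/-- The class of a conservative definition of truth modulo mutual definability. -/
def cls (α : full.Sentence) (h : IsConservativeTruthDefinition α) : DefinabilityOrder :=
  toAntisymmetrization (· ≤ ·) (⟨α, h⟩ : CDef)

end TruthDef

/-! ### Joint consistency -/

/-! A translation acts semantically: it turns a model of `β` into a structure with the same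
arithmetic, in which each predicate is read through its defining formula. Definability of `α` in `β`
thus says that every model of `β` becomes a model of `α` in one uniform way
(`definable_singleton_iff`).

Infima come from definition by cases. In a model of `α ⊔ β` the sentence `α` can be tested, so two
truth formulas, or two translations, merge into one that follows the first if `α` holds and the
second otherwise.

Suprema are formally easy once the symbols are disjoint, since translations of the two halves can be
glued. The real content is that `α ⊓ (renameBy ρ).apply β` is still consistent and conservative. By
conservativity and compactness, every model `M` of `EA` is elementarily equivalent to the
arithmetical parts of a model of `α` and of a model of `β` (`IsConservativeOverEA.exists_model`).
These two models need not share an arithmetical part, but Robinson's joint consistency theorem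
(`exists_common_reduct`) replaces them by models on one set with the same arithmetic. Overlaying
their predicates gives a model of the conjunction with the arithmetical theory of `M`
(`exists_model_inf_rename`).

Distributivity is then inherited from propositional logic, because one renaming serves all `β` and
commutes with disjunction. -/

namespace FirstOrder.Language

universe u v w

variable {L : Language.{u, v}}

/-! ### Saturation of ultrapowers -/

/-- Every countable set of formulas with countably many parameters that is finitely satisfiable
in the structure is satisfiable in it. -/
def CountablySaturated (L : Language.{u, v}) (M : Type w) [L.Structure M] : Prop :=
  ∀ (v : ℕ → M) (p : ℕ → L.Formula ℕ) (n : ℕ),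
    (∀ m, ∃ x, ∀ k < m, (p k).Realize (Function.update v n x)) →
      ∃ x, ∀ k, (p k).Realize (Function.update v n x)

/-- A diagonal argument. At index `a`, choose an element satisfying as many initial formulas as
possible, but at most the first `a`. By Łoś, any finite number of the formulas is jointly
satisfiable at almost every index, and almost every index is large because the ultrafilter is
nonprincipal. Hence each fixed formula holds of the chosen elements almost everywhere. -/
theorem countablySaturated_hyperfilter_product (M : Type w) [L.Structure M] [Nonempty M] :
    CountablySaturated L ((Filter.hyperfilter ℕ : Filter ℕ).Product fun _ => M) := by
  classical
  intro v p n h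
  obtain ⟨c, hc, hreal⟩ : ∃ c : (ℕ → M) → (Filter.hyperfilter ℕ : Filter ℕ).Product fun _ => M,
      Function.Surjective c ∧ ∀ (φ : L.Formula ℕ) (x : ℕ → ℕ → M),
        φ.Realize (fun i => c (x i)) ↔
          ∀ᶠ a in (Filter.hyperfilter ℕ : Filter ℕ), φ.Realize fun i => x i a :=
    ⟨fun x => (x : (Filter.hyperfilter ℕ : Filter ℕ).Product fun _ => M),
      fun x => Quotient.exists_rep x, fun φ x => Ultraproduct.realize_formula_cast φ x⟩
  choose r hr using fun i => hc (v i)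
  have key : ∀ (x : ℕ → M) (k : ℕ), (p k).Realize (Function.update v n (c x)) ↔
      ∀ᶠ a in (Filter.hyperfilter ℕ : Filter ℕ),
        (p k).Realize (Function.update (fun i => r i a) n (x a)) := by
    intro x k
    have h1 : Function.update v n (c x) = fun i => c (Function.update r n x i) := by
      funext i
      rcases eq_or_ne i n with rfl | hi
      · simp
      · simp [hi, hr]
    rw [h1, hreal]
    refine Filter.eventually_congr (Filter.Eventually.of_forall fun a => iff_of_eq ?_)
    congr 1
    funext i
    rcases eq_or_ne i n with rfl | hi
    · simp
    · simp [hi]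
  have hfin : ∀ m, ∀ᶠ a in (Filter.hyperfilter ℕ : Filter ℕ),
      ∃ x, ∀ k < m, (p k).Realize (Function.update (fun i => r i a) n x) := by
    intro m
    obtain ⟨x, hx⟩ := h m
    obtain ⟨y, rfl⟩ := hc x
    have : ∀ᶠ a in (Filter.hyperfilter ℕ : Filter ℕ), ∀ k ∈ Finset.range m,
        (p k).Realize (Function.update (fun i => r i a) n (y a)) :=
      (Filter.eventually_all_finset _).2 fun k hk => (key y k).1 (hx k (Finset.mem_range.1 hk))
    exact this.mono fun a ha => ⟨y a, fun k hk => ha k (Finset.mem_range.2 hk)⟩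
  let P : ℕ → ℕ → Prop := fun a m =>
    ∃ x, ∀ k < m, (p k).Realize (Function.update (fun i => r i a) n x)
  -- `P a 0` is vacuous, so the bounded search always succeeds.
  have hP : ∀ a, P a (Nat.findGreatest (P a) a) := fun a =>
    Nat.findGreatest_spec (Nat.zero_le a)
      (⟨Classical.arbitrary M, fun k hk => absurd hk (Nat.not_lt_zero k)⟩ : P a 0)
  choose y hy using hP
  refine ⟨c y, fun k => (key y k).2 ?_⟩
  have hge : ∀ᶠ a in (Filter.hyperfilter ℕ : Filter ℕ), k + 1 ≤ a :=
    (Filter.hyperfilter_le_cofinite.trans Nat.cofinite_eq_atTop.le)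
      (Filter.eventually_ge_atTop (k + 1))
  filter_upwards [hge, hfin (k + 1)] with a ha hPa
  exact hy a k (Nat.lt_of_lt_of_le k.lt_succ_self (Nat.le_findGreatest (P := P a) ha hPa))

/-! ### Back-and-forth over a sublanguage -/

/-- Two sequences satisfy the same formulas of a smaller language in the first `n` variables. -/
def SameType {L₀ : Language.{u, v}} (ϕ : L₀ →ᴸ L) {M N : Type w} [L.Structure M] [L.Structure N]
    (n : ℕ) (a : ℕ → M) (b : ℕ → N) : Prop :=
  ∀ φ : L₀.Formula (Fin n),
    (ϕ.onFormula φ).Realize (fun i => a i) ↔ (ϕ.onFormula φ).Realize fun i => b i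

section

variable {L₀ : Language.{u, v}} {ϕ : L₀ →ᴸ L} {M N : Type w} [L.Structure M] [L.Structure N]

theorem SameType.symm {n : ℕ} {a : ℕ → M} {b : ℕ → N} (h : SameType ϕ n a b) : SameType ϕ n b a :=
  fun φ => (h φ).symm

/-- The formula obtained by existentially quantifying the last variable. -/
noncomputable def Formula.exLast {n : ℕ} (φ : L.Formula (Fin (n + 1))) : L.Formula (Fin n) :=
  (BoundedFormula.relabel (n := 1) (k := 0)
    (Fin.snoc Sum.inl (Sum.inr 0) : Fin (n + 1) → Fin n ⊕ Fin 1) φ).ex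

theorem update_comp_val (v : ℕ → M) (n : ℕ) (x : M) :
    (fun i : Fin (n + 1) => Function.update v n x i) = Fin.snoc (fun i : Fin n => v i) x := by
  funext i
  refine Fin.lastCases ?_ (fun i => ?_) i
  · simp
  · simp [i.isLt.ne]

theorem Formula.realize_exLast {n : ℕ} (φ : L.Formula (Fin (n + 1))) (v : ℕ → M) :
    φ.exLast.Realize (fun i => v i) ↔ ∃ x, φ.Realize fun i => Function.update v n x i := by
  unfold Formula.exLast
  rw [Formula.Realize, BoundedFormula.realize_ex]
  refine exists_congr fun x => ?_
  rw [BoundedFormula.realize_relabel, Formula.Realize, update_comp_val]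
  refine iff_of_eq ?_
  congr 1
  · funext i
    refine Fin.lastCases ?_ (fun i => ?_) i
    · simp [Fin.snoc]
    · simp
  · exact Subsingleton.elim _ _

/-- The complete `L₀`-type of `x` over `a` is transferred to `b`. Existentially quantifying a finite
conjunction from it gives a formula true of `a`, hence of `b`, so the type is finitely satisfiable
over `b`; saturation supplies `y`. Completeness of the type yields both directions of the
equivalence. -/
theorem SameType.exists_update [Countable L₀.Symbols] {n : ℕ} {a : ℕ → M} {b : ℕ → N}
    (h : SameType ϕ n a b) (hN : CountablySaturated L N) (x : M) :
    ∃ y, SameType ϕ (n + 1) (Function.update a n x) (Function.update b n y) := by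
  classical
  obtain ⟨e, he⟩ := exists_surjective_nat (L₀.Formula (Fin (n + 1)))
  let q : ℕ → L₀.Formula (Fin (n + 1)) := fun k =>
    if (ϕ.onFormula (e k)).Realize (fun i => Function.update a n x i) then e k else (e k).not
  have hq : ∀ k, (ϕ.onFormula (q k)).Realize fun i => Function.update a n x i := by
    intro k
    by_cases hk : (ϕ.onFormula (e k)).Realize fun i => Function.update a n x i
    · simp only [q, if_pos hk, hk]
    · simp only [q, if_neg hk]
      exact hk
  have hfin : ∀ m, ∃ y, ∀ k < m, (ϕ.onFormula (q k)).Realize fun i => Function.update b n y i := by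
    intro m
    let := ϕ.reduct M
    let := ϕ.reduct N
    let ψ : L₀.Formula (Fin (n + 1)) := ((List.range m).map q).foldr (· ⊓ ·) ⊤
    have hψ : (ϕ.onFormula (ψ.exLast)).Realize (fun i => a i) := by
      rw [LHom.realize_onFormula, Formula.realize_exLast]
      refine ⟨x, (BoundedFormula.realize_foldr_inf _ _ _).2 ?_⟩
      intro χ hχ
      obtain ⟨k, -, rfl⟩ := List.mem_map.1 hχ
      exact (LHom.realize_onFormula ϕ (q k)).1 (hq k)
    rw [h, LHom.realize_onFormula, Formula.realize_exLast] at hψ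
    obtain ⟨y, hy⟩ := hψ
    refine ⟨y, fun k hk => (LHom.realize_onFormula ϕ (q k)).2 ?_⟩
    exact (BoundedFormula.realize_foldr_inf _ _ _).1 hy _
      (List.mem_map.2 ⟨k, List.mem_range.2 hk, rfl⟩)
  obtain ⟨y, hy⟩ := hN b (fun k => (ϕ.onFormula (q k)).relabel Fin.val) n
    (by simpa only [Formula.realize_relabel, Function.comp_def] using hfin)
  simp only [Formula.realize_relabel, Function.comp_def] at hy
  refine ⟨y, fun φ => ?_⟩
  obtain ⟨k, rfl⟩ := he φ
  have hk := hy k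
  by_cases h' : (ϕ.onFormula (e k)).Realize fun i => Function.update a n x i
  · simp only [q, if_pos h'] at hk
    exact iff_of_true h' hk
  · simp only [q, if_neg h'] at hk
    exact iff_of_false h' hk

theorem SameType.exists_update_left [Countable L₀.Symbols] {n : ℕ} {a : ℕ → M} {b : ℕ → N}
    (h : SameType ϕ n a b) (hM : CountablySaturated L M) (y : N) :
    ∃ x, SameType ϕ (n + 1) (Function.update a n x) (Function.update b n y) :=
  let ⟨x, hx⟩ := h.symm.exists_update hM y
  ⟨x, hx.symm⟩

/-- Back-and-forth: the values of the sequences form elementary substructures, and the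
sequences satisfy the same formulas of the smaller language. -/
theorem exists_tarskiVaught_sequences [Countable L₀.Symbols] [Countable L.Symbols]
    [Nonempty M] [Nonempty N] (hM : CountablySaturated L M) (hN : CountablySaturated L N)
    (h : ∀ σ : L₀.Sentence, M ⊨ ϕ.onSentence σ ↔ N ⊨ ϕ.onSentence σ) :
    ∃ (a : ℕ → M) (b : ℕ → N),
      (∀ (m : ℕ) (φ : L₀.Formula (Fin m)) (i : Fin m → ℕ),
        (ϕ.onFormula φ).Realize (fun j => a (i j)) ↔ (ϕ.onFormula φ).Realize fun j => b (i j)) ∧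
      (∀ (m : ℕ) (φ : L.BoundedFormula Empty (m + 1)) (i : Fin m → ℕ) (x : M),
        φ.Realize default (Fin.snoc (fun j => a (i j)) x) →
          ∃ n, φ.Realize default (Fin.snoc (fun j => a (i j)) (a n))) ∧
      (∀ (m : ℕ) (φ : L.BoundedFormula Empty (m + 1)) (i : Fin m → ℕ) (y : N),
        φ.Realize default (Fin.snoc (fun j => b (i j)) y) →
          ∃ n, φ.Realize default (Fin.snoc (fun j => b (i j)) (b n))) := by
  classical
  -- A task is one instance of the Tarski-Vaught test: a formula, with parameters given by positions
  -- in the sequence. The two summands of `Task ⊕ Task` refer to the two sides.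
  let Task := Σ m, L.BoundedFormula Empty (m + 1) × (Fin m → ℕ)
  have hcount (m : ℕ) : Countable (L.BoundedFormula Empty m) :=
    (sigma_mk_injective (β := fun n => L.BoundedFormula Empty n) (i := m)).countable
  have : Nonempty Task := ⟨⟨0, ⊥, Fin.elim0⟩⟩
  have : Countable Task := inferInstanceAs (Countable (Σ m, _))
  obtain ⟨task, htask⟩ := exists_surjective_nat (Task ⊕ Task)
  -- Only the first `n` entries count as built; later ones are placeholders that are overwritten in
  -- turn.
  let State (n : ℕ) := {s : (ℕ → M) × (ℕ → N) // SameType ϕ n s.1 s.2}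
  have h₀ : SameType ϕ 0 (fun _ => Classical.arbitrary M) (fun _ => Classical.arbitrary N) := by
    intro φ
    let := ϕ.reduct M
    let := ϕ.reduct N
    have hφ := h (φ.relabel Fin.elim0)
    rw [LHom.realize_onSentence, LHom.realize_onSentence, Sentence.Realize, Sentence.Realize,
      Formula.realize_relabel, Formula.realize_relabel] at hφ
    rw [LHom.realize_onFormula, LHom.realize_onFormula]
    convert! hφ using 2
  have step : ∀ (n : ℕ) (s : State n) (t : Task ⊕ Task), ∃ s' : State (n + 1),
      (∀ i, i ≠ n → s'.1.1 i = s.1.1 i ∧ s'.1.2 i = s.1.2 i) ∧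
      (∀ u : Task, t = .inl u → ∀ x, u.2.1.Realize default (Fin.snoc (fun j => s.1.1 (u.2.2 j)) x) →
        u.2.1.Realize default (Fin.snoc (fun j => s.1.1 (u.2.2 j)) (s'.1.1 n))) ∧
      (∀ u : Task, t = .inr u → ∀ y, u.2.1.Realize default (Fin.snoc (fun j => s.1.2 (u.2.2 j)) y) →
        u.2.1.Realize default (Fin.snoc (fun j => s.1.2 (u.2.2 j)) (s'.1.2 n))) := by
    rintro n ⟨⟨a, b⟩, hab⟩ (u | u)
    · obtain ⟨x, hx⟩ : ∃ x, ∀ z, u.2.1.Realize default (Fin.snoc (fun j => a (u.2.2 j)) z) →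
          u.2.1.Realize default (Fin.snoc (fun j => a (u.2.2 j)) x) := by
        -- If the task has no witness it imposes nothing, and `a 0` is an arbitrary filler.
        by_cases h : ∃ x, u.2.1.Realize default (Fin.snoc (fun j => a (u.2.2 j)) x)
        · exact h.imp fun x hx _ _ => hx
        · exact ⟨a 0, fun z hz => absurd ⟨z, hz⟩ h⟩
      obtain ⟨y, hy⟩ := hab.exists_update hN x
      refine ⟨⟨(_, _), hy⟩, fun i hi => ⟨Function.update_of_ne hi _ _,
        Function.update_of_ne hi _ _⟩, ?_, fun _ h => by simp at h⟩
      rintro _ ⟨⟩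
      have e : Function.update a n x n = x := Function.update_self ..
      change ∀ z, _ → u.2.1.Realize default (Fin.snoc _ (Function.update a n x n))
      rw [e]
      exact hx
    · obtain ⟨y, hy⟩ : ∃ y, ∀ z, u.2.1.Realize default (Fin.snoc (fun j => b (u.2.2 j)) z) →
          u.2.1.Realize default (Fin.snoc (fun j => b (u.2.2 j)) y) := by
        by_cases h : ∃ y, u.2.1.Realize default (Fin.snoc (fun j => b (u.2.2 j)) y)
        · exact h.imp fun y hy _ _ => hy
        · exact ⟨b 0, fun z hz => absurd ⟨z, hz⟩ h⟩
      obtain ⟨x, hx⟩ := hab.exists_update_left hM y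
      refine ⟨⟨(_, _), hx⟩, fun i hi => ⟨Function.update_of_ne hi _ _,
        Function.update_of_ne hi _ _⟩, fun _ h => by simp at h, ?_⟩
      rintro _ ⟨⟩
      have e : Function.update b n y n = y := Function.update_self ..
      change ∀ z, _ → u.2.1.Realize default (Fin.snoc _ (Function.update b n y n))
      rw [e]
      exact hy
  choose next hoff hleft hright using step
  -- Taking the first component of `n.unpair` makes every task recur at infinitely many stages, so
  -- some occurrence comes after all its parameters have been built.
  let s : ∀ n, State n := fun n => Nat.rec ⟨(_, _), h₀⟩ (fun n t => next n t (task n.unpair.1)) n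
  have hs : ∀ n, s (n + 1) = next n (s n) (task n.unpair.1) := fun n => rfl
  have hlim : ∀ i n, i < n → (s n).1.1 i = (s (i + 1)).1.1 i ∧ (s n).1.2 i = (s (i + 1)).1.2 i := by
    intro i n hin
    induction n, hin using Nat.le_induction with
    | base => exact ⟨rfl, rfl⟩
    | succ n hn ih =>
      rw [hs n, (hoff n (s n) (task n.unpair.1) i (by lia)).1,
        (hoff n (s n) (task n.unpair.1) i (by lia)).2]
      exact ih
  have hbound : ∀ {m : ℕ} (i : Fin m → ℕ), ∃ K, ∀ j, i j < K := fun i =>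
    ⟨Finset.univ.sup i + 1, fun j => Nat.lt_succ_of_le (Finset.le_sup (Finset.mem_univ j))⟩
  refine ⟨fun i => (s (i + 1)).1.1 i, fun i => (s (i + 1)).1.2 i, ?_, ?_, ?_⟩
  · intro m φ i
    obtain ⟨K, hK⟩ := hbound i
    have h := (s K).2 (φ.relabel fun j => ⟨i j, hK j⟩)
    let := ϕ.reduct M
    let := ϕ.reduct N
    simp only [LHom.realize_onFormula, Formula.realize_relabel] at h ⊢
    convert! h using 2 <;> funext j
    · exact (hlim _ _ (hK j)).1.symm
    · exact (hlim _ _ (hK j)).2.symm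
  · intro m φ i x hx
    obtain ⟨K, hK⟩ := hbound i
    obtain ⟨k, hk⟩ := htask (.inl ⟨m, φ, i⟩)
    -- Stage `Nat.pair k K` treats task `k` and is at least `K`, which exceeds every parameter
    -- position; the witness is the entry built at this stage.
    refine ⟨Nat.pair k K, ?_⟩
    have h := hleft (Nat.pair k K) (s (Nat.pair k K)) (task (Nat.pair k K).unpair.1) ⟨m, φ, i⟩
      (by simp [hk]) x
    rw [← hs] at h
    simp only [fun j => (hlim _ _ ((hK j).trans_le (Nat.right_le_pair k K))).1] at h
    exact h hx
  · intro m φ i y hy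
    obtain ⟨K, hK⟩ := hbound i
    obtain ⟨k, hk⟩ := htask (.inr ⟨m, φ, i⟩)
    refine ⟨Nat.pair k K, ?_⟩
    have h := hright (Nat.pair k K) (s (Nat.pair k K)) (task (Nat.pair k K).unpair.1) ⟨m, φ, i⟩
      (by simp [hk]) y
    rw [← hs] at h
    simp only [fun j => (hlim _ _ ((hK j).trans_le (Nat.right_le_pair k K))).2] at h
    exact h hy

/-! ### Elementary substructures with a common reduct -/

/-- The range of a sequence that passes the Tarski-Vaught test, as an elementary substructure. -/
theorem exists_elementarySubstructure_range (a : ℕ → M)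
    (ha : ∀ (m : ℕ) (φ : L.BoundedFormula Empty (m + 1)) (i : Fin m → ℕ) (x : M),
      φ.Realize default (Fin.snoc (fun j => a (i j)) x) →
        ∃ n, φ.Realize default (Fin.snoc (fun j => a (i j)) (a n))) :
    ∃ S : L.ElementarySubstructure M, (S : Set M) = Set.range a := by
  have hsurj : ∀ {m : ℕ} (x : Fin m → M), (∀ j, x j ∈ Set.range a) →
      ∃ i : Fin m → ℕ, x = fun j => a (i j) := by
    intro m x hx
    choose i hi using hx
    exact ⟨i, funext fun j => (hi j).symm⟩
  let S : L.Substructure M := ⟨Set.range a, by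
    intro n f x hx
    obtain ⟨i, rfl⟩ := hsurj x hx
    -- Closure under `f` is the Tarski-Vaught test for the formula `f(x₁, …, xₙ) = y`.
    let t : L.Term (Empty ⊕ Fin (n + 1)) := Term.func f fun j => Term.var (Sum.inr j.castSucc)
    have hreal : ∀ y, (t.bdEqual (Term.var (Sum.inr (Fin.last n)))).Realize default
        (Fin.snoc (fun j => a (i j)) y) ↔ Structure.funMap f (fun j => a (i j)) = y := by
      intro y
      simp [t, BoundedFormula.realize_bdEqual, Term.realize]
    obtain ⟨k, hk⟩ := ha n _ i _ ((hreal _).2 rfl)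
    exact ⟨k, ((hreal _).1 hk).symm⟩⟩
  refine ⟨S.toElementarySubstructure ?_, rfl⟩
  intro n φ x y hy
  obtain ⟨i, hi⟩ := hsurj (fun j => (x j : M)) fun j => (x j).2
  have hi' : ((↑) ∘ x : Fin n → M) = fun j => a (i j) := hi
  rw [hi'] at hy ⊢
  obtain ⟨k, hk⟩ := ha n φ i y hy
  exact ⟨⟨a k, k, rfl⟩, hk⟩

variable (ϕ) in
/-- Robinson's joint consistency theorem: structures that satisfy the same sentences of a smaller
language are elementarily equivalent to structures on the same set that interpret the smaller
language in the same way. -/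
theorem exists_common_reduct [Countable L₀.Symbols] [Countable L.Symbols]
    [Nonempty M] [Nonempty N]
    (h : ∀ σ : L₀.Sentence, M ⊨ ϕ.onSentence σ ↔ N ⊨ ϕ.onSentence σ) :
    ∃ (K : Type w) (S T : L.Structure K), Nonempty K ∧
      (∀ (n : ℕ) (f : L₀.Functions n), S.funMap (ϕ.onFunction f) = T.funMap (ϕ.onFunction f)) ∧
      (∀ (n : ℕ) (R : L₀.Relations n), S.RelMap (ϕ.onRelation R) = T.RelMap (ϕ.onRelation R)) ∧
      (∀ σ : L.Sentence, @Sentence.Realize L K S σ ↔ M ⊨ σ) ∧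
      (∀ σ : L.Sentence, @Sentence.Realize L K T σ ↔ N ⊨ σ) := by
  let M' := (Filter.hyperfilter ℕ : Filter ℕ).Product fun _ => M
  let N' := (Filter.hyperfilter ℕ : Filter ℕ).Product fun _ => N
  have hMM' : ∀ σ : L.Sentence, M' ⊨ σ ↔ M ⊨ σ := fun σ => by
    rw [Ultraproduct.sentence_realize, Filter.eventually_const]
  have hNN' : ∀ σ : L.Sentence, N' ⊨ σ ↔ N ⊨ σ := fun σ => by
    rw [Ultraproduct.sentence_realize, Filter.eventually_const]
  have : Nonempty M' := inferInstance
  have : Nonempty N' := inferInstance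
  obtain ⟨a, b, hab, ha, hb⟩ := exists_tarskiVaught_sequences (ϕ := ϕ) (M := M') (N := N')
    (countablySaturated_hyperfilter_product M) (countablySaturated_hyperfilter_product N)
    fun σ => (hMM' _).trans ((h σ).trans (hNN' _).symm)
  obtain ⟨S, hS⟩ := exists_elementarySubstructure_range a ha
  obtain ⟨T, hT⟩ := exists_elementarySubstructure_range b hb
  have memS (i : ℕ) : a i ∈ S := by
    rw [← SetLike.mem_coe, hS]; exact ⟨i, rfl⟩
  have memT (i : ℕ) : b i ∈ T := by
    rw [← SetLike.mem_coe, hT]; exact ⟨i, rfl⟩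
  have exS (x : S) : ∃ i, (⟨a i, memS i⟩ : S) = x := by
    have hx := x.2
    rw [← SetLike.mem_coe, hS] at hx
    exact hx.imp fun i hi => Subtype.ext hi
  have exT (x : T) : ∃ i, (⟨b i, memT i⟩ : T) = x := by
    have hx := x.2
    rw [← SetLike.mem_coe, hT] at hx
    exact hx.imp fun i hi => Subtype.ext hi
  let := ϕ.reduct M'
  let := ϕ.reduct N'
  simp only [LHom.realize_onFormula] at hab
  -- Equality is a formula of `L₀`, so `a i ↦ b i` is well defined and injective.
  have heq (i j : ℕ) : a i = a j ↔ b i = b j := by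
    have := hab 2 ((Term.var 0).equal (Term.var 1)) ![i, j]
    simpa [Formula.realize_equal] using this
  choose c hc using exS
  choose d hd using exT
  let e : S ≃ T :=
    { toFun := fun x => ⟨b (c x), memT _⟩
      invFun := fun y => ⟨a (d y), memS _⟩
      left_inv := fun x => by
        rw [← hc x, Subtype.mk.injEq, heq, hc x]
        exact congrArg Subtype.val (hd ⟨b (c x), memT _⟩)
      right_inv := fun y => by
        rw [← hd y, Subtype.mk.injEq, ← heq, hd y]
        exact congrArg Subtype.val (hc ⟨a (d y), memS _⟩) }
  have he (i : ℕ) : e ⟨a i, memS i⟩ = ⟨b i, memT i⟩ := by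
    refine Subtype.ext ((heq _ _).1 ?_)
    exact congrArg Subtype.val (hc ⟨a i, memS i⟩)
  have hcomp {n : ℕ} (i : Fin n → ℕ) :
      (e ∘ fun j => ⟨a (i j), memS _⟩) = fun j => ⟨b (i j), memT _⟩ := funext fun j => he (i j)
  have hfun {n : ℕ} (f : L₀.Functions n) (i : Fin n → ℕ) (k : ℕ) :
      Structure.funMap (ϕ.onFunction f) (fun j => a (i j)) = a k ↔
        Structure.funMap (ϕ.onFunction f) (fun j => b (i j)) = b k := by
    have := hab (n + 1) ((Term.func f fun j => Term.var j.castSucc).equal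
      (Term.var (Fin.last n))) (Fin.snoc i k)
    simpa [Formula.realize_equal, Term.realize] using this
  have hrel {n : ℕ} (R : L₀.Relations n) (i : Fin n → ℕ) :
      Structure.RelMap (ϕ.onRelation R) (fun j => a (i j)) ↔
        Structure.RelMap (ϕ.onRelation R) (fun j => b (i j)) := by
    have := hab n (R.formula Term.var) i
    simpa [Formula.realize_rel] using this
  -- The common domain is `S`, once with its own structure and once with that of `T` carried back
  -- along `e`. They agree on `L₀` because `e` preserves its symbols.
  refine ⟨S, inferInstance, Equiv.inducedStructure e.symm, inferInstance, ?_, ?_, ?_, ?_⟩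
  · intro n f
    funext x
    obtain ⟨i, rfl⟩ : ∃ i : Fin n → ℕ, x = fun j => ⟨a (i j), memS _⟩ :=
      ⟨fun j => c (x j), funext fun j => (hc (x j)).symm⟩
    apply e.injective
    change _ = e (e.symm (Structure.funMap (ϕ.onFunction f) (e ∘ _)))
    rw [e.apply_symm_apply, hcomp, ← hc (Structure.funMap _ _), he]
    refine Subtype.ext ((hfun f i _).1 ?_).symm
    exact (congrArg Subtype.val
      (hc (Structure.funMap (ϕ.onFunction f) fun j => (⟨a (i j), memS _⟩ : S)))).symm
  · intro n R
    funext x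
    obtain ⟨i, rfl⟩ : ∃ i : Fin n → ℕ, x = fun j => ⟨a (i j), memS _⟩ :=
      ⟨fun j => c (x j), funext fun j => (hc (x j)).symm⟩
    change _ = Structure.RelMap (ϕ.onRelation R) (e ∘ _)
    rw [hcomp]
    exact propext (hrel R i)
  · exact fun σ => (S.realize_sentence σ).trans (hMM' σ)
  · intro σ
    let := Equiv.inducedStructure (L := L) e.symm
    refine Iff.trans ?_ ((T.realize_sentence σ).trans (hNN' σ))
    exact (StrongHomClass.realize_sentence (Equiv.inducedStructureEquiv (L := L) e.symm) σ).symm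

end

end FirstOrder.Language

namespace TruthDef

/-! ### Semantic descriptions of the notions -/

/-- This permits changing the predicates that do not occur in a sentence, as is needed when models
or translations are glued together. -/
theorem realize_congr_symbols {K : Type*} {α : Type} (S T : full.Structure K) {n : ℕ}
    (φ : full.BoundedFormula α n)
    (hf : ∀ (l : ℕ) (f : full.Functions l), S.funMap f = T.funMap f)
    (hR : ∀ (l : ℕ) (R : arith.Relations l), S.RelMap (Sum.inl R) = T.RelMap (Sum.inl R))
    (hP : ∀ l k : ℕ, (l, k) ∈ symbols φ →
      S.RelMap (Sum.inr k : full.Relations l) = T.RelMap (Sum.inr k : full.Relations l))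
    (v : α → K) (xs : Fin n → K) :
    @BoundedFormula.Realize full K S _ _ φ v xs ↔ @BoundedFormula.Realize full K T _ _ φ v xs := by
  have hterm : ∀ {β : Type} (t : full.Term β) (w : β → K),
      @Term.realize full K S β w t = @Term.realize full K T β w t := by
    intro β t w
    induction t with
    | var => rfl
    | func f ts ih =>
      simp only [Term.realize, hf]
      exact congrArg _ (funext ih)
  induction φ with
  | falsum => rfl
  | equal t u => simp only [BoundedFormula.Realize, hterm]
  | rel R t =>
    cases R with
    | inl R => simp only [BoundedFormula.Realize, hterm, hR]
    | inr k =>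
      have := hP _ k (Finset.mem_singleton_self _)
      simp only [BoundedFormula.Realize, hterm, this]
  | imp φ ψ ih1 ih2 =>
    simp only [symbols, Finset.mem_union] at hP
    simp only [BoundedFormula.Realize, ih1 fun l k h => hP l k (.inl h),
      ih2 fun l k h => hP l k (.inr h)]
  | all φ ih => exact forall_congr' fun x => ih hP _

theorem symbols_onBoundedFormula {α : Type} {n : ℕ} (φ : arith.BoundedFormula α n) :
    symbols ((LHom.sumInl : arith →ᴸ full).onBoundedFormula φ) = ∅ := by
  induction φ with
  | falsum => rfl
  | equal => rfl
  | rel => rfl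
  | imp _ _ ih1 ih2 =>
    simp only [LHom.onBoundedFormula, symbols, ih1, ih2, Finset.union_empty]
  | all _ ih => simpa only [LHom.onBoundedFormula, symbols] using ih

theorem symbols_ofArith (σ : arith.Sentence) : symbols (ofArith σ) = ∅ :=
  symbols_onBoundedFormula σ

theorem symbols_relabel {α β : Type} {m k : ℕ} (g : α → β ⊕ Fin m) (φ : full.BoundedFormula α k) :
    symbols (φ.relabel g) = symbols φ :=
  symbols_mapTermRel _ _ (fun _ _ => symbols_castLE _ _) _

theorem symbols_sup {α : Type} {n : ℕ} (φ ψ : full.BoundedFormula α n) :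
    symbols (φ ⊔ ψ) = symbols φ ∪ symbols ψ := by
  change (symbols φ ∪ ∅) ∪ symbols ψ = _
  rw [Finset.union_empty]

theorem symbols_inf {α : Type} {n : ℕ} (φ ψ : full.BoundedFormula α n) :
    symbols (φ ⊓ ψ) = symbols φ ∪ symbols ψ := by
  change (symbols φ ∪ (symbols ψ ∪ ∅)) ∪ ∅ = _
  rw [Finset.union_empty, Finset.union_empty]

theorem symbols_not {α : Type} {n : ℕ} (φ : full.BoundedFormula α n) :
    symbols φ.not = symbols φ :=
  Finset.union_empty _

theorem signature_singleton (α : full.Sentence) :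
    signature {α} = (symbols α : Set (ℕ × ℕ)) := by
  ext P
  simp [signature]

theorem symbols_apply_renameBy (ρ : ℕ → ℕ → ℕ) {α : Type} {n : ℕ} (φ : full.BoundedFormula α n) :
    symbols ((renameBy ρ).apply φ) = (symbols φ).image fun P => (P.1, ρ P.1 P.2) := by
  induction φ with
  | falsum => rfl
  | equal => rfl
  | rel R t =>
    cases R with
    | inl R => rfl
    | inr k =>
      simp only [Translation.apply, symbols_inst, symbols_renameBy, symbols,
        Finset.image_singleton]
  | imp _ _ ih1 ih2 =>
    simp only [Translation.apply, symbols, ih1, ih2, Finset.image_union]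
  | all _ ih => simpa only [Translation.apply, symbols] using ih

theorem singleton_models_iff {α φ : full.Sentence} :
    ({α} : full.Theory) ⊨ᵇ φ ↔ ∀ (K : Type) (S : full.Structure K), Nonempty K →
      @Sentence.Realize full K S α → @Sentence.Realize full K S φ := by
  rw [Theory.models_sentence_iff]
  constructor
  · intro h K S hK hα
    have : K ⊨ ({α} : full.Theory) := by simpa [Theory.model_iff] using hα
    exact h (Theory.ModelType.of _ K)
  · intro h M
    exact h M M.struc inferInstance (Theory.realize_sentence_of_mem {α} rfl)

theorem singleton_isSatisfiable_iff {α : full.Sentence} :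
    ({α} : full.Theory).IsSatisfiable ↔ ∃ (K : Type) (S : full.Structure K), Nonempty K ∧
      @Sentence.Realize full K S α := by
  constructor
  · rintro ⟨M⟩
    exact ⟨M, M.struc, inferInstance, Theory.realize_sentence_of_mem {α} rfl⟩
  · rintro ⟨K, S, hK, hα⟩
    have : K ⊨ ({α} : full.Theory) := by simpa [Theory.model_iff] using hα
    exact ⟨Theory.ModelType.of _ K⟩

theorem definable_singleton_iff {α β : full.Sentence} :
    Definable {α} {β} ↔ ∃ s : Translation,
      (∀ n k, (n, k) ∈ symbols α → symbols (s n k) ⊆ symbols β) ∧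
      ∀ (K : Type) (S : full.Structure K), Nonempty K → @Sentence.Realize full K S β →
        @Sentence.Realize full K (reinterpret s S) α := by
  simp only [Definable, Translation.MapsTo, signature_singleton, Finset.mem_coe,
    Finset.coe_subset, Set.mem_singleton_iff, forall_eq, singleton_models_iff]
  refine exists_congr fun s => and_congr Iff.rfl (forall_congr' fun K => forall_congr' fun S =>
    forall_congr' fun _ => forall_congr' fun _ => ?_)
  exact realize_apply s S α _ _

theorem definable_of_imp {α β : full.Sentence} (hs : symbols α ⊆ symbols β)
    (h : ∀ (K : Type) (S : full.Structure K), Nonempty K → @Sentence.Realize full K S β →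
      @Sentence.Realize full K S α) : Definable {α} {β} := by
  refine definable_singleton_iff.2 ⟨renameBy fun _ k => k, fun n k hk => ?_, fun K S hK hβ => ?_⟩
  · rw [symbols_renameBy]
    exact Finset.singleton_subset_iff.2 (hs hk)
  · rw [reinterpret_renameBy_self]
    exact h K S hK hβ

/-! ### Conservativity -/

/-- Compactness: if `α` were inconsistent with the complete theory of `M`, it would refute a finite
conjunction `τ` of sentences true in `M`. By conservativity `EA` would refute `τ`, although `M` is a
model of `EA`. -/
theorem IsConservativeOverEA.exists_model {α : full.Sentence} (h : IsConservativeOverEA {α})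
    (M : Type) [arith.Structure M] [Nonempty M] (hM : M ⊨ EA) :
    ∃ (K : Type) (S : full.Structure K), Nonempty K ∧ @Sentence.Realize full K S α ∧
      ∀ σ : arith.Sentence, @Sentence.Realize full K S (ofArith σ) ↔ M ⊨ σ := by
  classical
  by_cases hsat : (ofArith '' arith.completeTheory M ∪ {α} : full.Theory).IsSatisfiable
  · obtain ⟨K⟩ := hsat
    have himp : ∀ σ : arith.Sentence, M ⊨ σ → K ⊨ ofArith σ := fun σ hσ =>
      Theory.realize_sentence_of_mem (ofArith '' arith.completeTheory M ∪ {α})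
        (.inl ⟨σ, hσ, rfl⟩)
    refine ⟨K, K.struc, inferInstance,
      Theory.realize_sentence_of_mem (ofArith '' arith.completeTheory M ∪ {α}) (.inr rfl),
      fun σ => ⟨fun hσ => ?_, himp σ⟩⟩
    by_contra hn
    exact himp σ.not ((Sentence.realize_not _).2 hn) hσ
  · exfalso
    have hmod : (ofArith '' arith.completeTheory M : full.Theory) ⊨ᵇ α.not := by
      rw [Theory.models_sentence_iff]
      intro K hK
      refine hsat ⟨@Theory.ModelType.mk _ _ K K.struc ?_ inferInstance⟩
      rw [Theory.model_union_iff]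
      exact ⟨K.is_model, (Theory.model_singleton_iff).2 hK⟩
    obtain ⟨T0, hT0, hT0α⟩ := Theory.models_iff_finset_models.1 hmod
    obtain ⟨T1, hT1, rfl⟩ := Finset.subset_set_image_iff.1 hT0
    let τ : arith.Sentence := T1.toList.foldr (· ⊓ ·) ⊤
    have hτ : ∀ {K : Type} [arith.Structure K], K ⊨ τ ↔ ∀ σ ∈ T1, K ⊨ σ := by
      intro K _
      refine (BoundedFormula.realize_foldr_inf _ _ _).trans ?_
      simp only [Finset.mem_toList]
      rfl
    have hα : ({α} : full.Theory) ⊨ᵇ ofArith τ.not := by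
      rw [singleton_models_iff]
      intro K S hK hα
      let := (LHom.sumInl : arith →ᴸ full).reduct K
      refine (LHom.realize_onSentence K (LHom.sumInl : arith →ᴸ full) _).2 ?_
      rw [Sentence.realize_not, hτ]
      intro hall
      have : K ⊨ ((T1.image ofArith : Finset full.Sentence) : full.Theory) := by
        rw [Theory.model_iff]
        intro φ hφ
        obtain ⟨σ, hσ, rfl⟩ := Finset.mem_image.1 (Finset.mem_coe.1 hφ)
        exact (LHom.realize_onSentence K (LHom.sumInl : arith →ᴸ full) _).2 (hall σ hσ)
      exact Theory.models_sentence_iff.1 hT0α (Theory.ModelType.of _ K) hα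
    have := Theory.models_sentence_iff.1 (h _ hα) (Theory.ModelType.of _ M)
    exact (Sentence.realize_not _).1 this (hτ.2 fun σ hσ => hT1 hσ)

instance (n : ℕ) : Countable (ArithFunc n) :=
  Function.Injective.countable (β := ℕ)
    (f := fun | .zero => 0 | .one => 1 | .add => 2 | .mul => 3) fun a b h => by
      cases a <;> cases b <;> simp_all

instance (n : ℕ) : Countable (ArithRel n) :=
  have : Subsingleton (ArithRel n) := ⟨by rintro ⟨⟩ ⟨⟩; rfl⟩
  inferInstance

instance : Countable arith.Symbols :=
  inferInstanceAs (Countable ((Σ n, ArithFunc n) ⊕ Σ n, ArithRel n))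

instance : Countable full.Symbols :=
  inferInstanceAs (Countable ((Σ n, ArithFunc n ⊕ Empty) ⊕ Σ n, ArithRel n ⊕ ℕ))

/-- Conservative extensions of `EA` by disjoint sets of symbols have a common model over each
model of `EA`. -/
theorem exists_model_inf_rename {α β : full.Sentence} (hα : IsConservativeOverEA {α})
    (hβ : IsConservativeOverEA {β}) {ρ : ℕ → ℕ → ℕ} (hρ : RenamesApart ρ α β)
    (M : Type) [arith.Structure M] [Nonempty M] (hM : M ⊨ EA) :
    ∃ (K : Type) (S : full.Structure K), Nonempty K ∧
      @Sentence.Realize full K S (α ⊓ (renameBy ρ).apply β) ∧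
      ∀ σ : arith.Sentence, @Sentence.Realize full K S (ofArith σ) ↔ M ⊨ σ := by
  classical
  obtain ⟨A, SA, hA, hAα, hAM⟩ := hα.exists_model M hM
  obtain ⟨B, SB, hB, hBβ, hBM⟩ := hβ.exists_model M hM
  obtain ⟨K, S, T, hK, hfun, hrel, hS, hT⟩ := exists_common_reduct (M := A) (N := B)
    (LHom.sumInl : arith →ᴸ full) fun σ => (hAM σ).trans (hBM σ).symm
  -- Symbols of `α` are read from `S`, and the renamed symbols of `β` from `T`. Renaming apart rules
  -- out a clash between the two clauses, and injectivity makes the preimage `k` unique among the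
  -- symbols of `β`.
  let U : full.Structure K :=
    { funMap := S.funMap
      RelMap := fun {l} R v => match R with
        | .inl R => S.RelMap (.inl R) v
        | .inr m => if (l, m) ∈ symbols α then S.RelMap (.inr m : full.Relations l) v else
            ∃ k, (l, k) ∈ symbols β ∧ ρ l k = m ∧ T.RelMap (.inr k : full.Relations l) v }
  have hUS : ∀ φ : full.Sentence, symbols φ ⊆ symbols α →
      (@Sentence.Realize full K U φ ↔ @Sentence.Realize full K S φ) := fun φ hφ =>
    realize_congr_symbols U S φ (fun _ _ => rfl) (fun _ _ => rfl)
      (fun l k h => funext fun v => if_pos (hφ h)) _ _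
  refine ⟨K, U, hK, ?_, fun σ => ?_⟩
  · refine (@Sentence.realize_inf full K U _ _).2
      ⟨(hUS α subset_rfl).2 ((hS α).2 hAα), (realize_apply _ U β _ _).2 ?_⟩
    refine (realize_congr_symbols _ T β ?_ ?_ ?_ _ _).2 ((hT β).2 hBβ)
    · rintro l (f | f)
      · exact hfun l f
      · exact f.elim
    · exact hrel
    · intro l k hk
      funext v
      refine (propext (@Formula.realize_rel full K U _ _ _ _ _)).trans ?_
      change (if (l, ρ l k) ∈ symbols α then _ else _) = _
      rw [if_neg (hρ.2 _ hk)]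
      refine propext ⟨?_, fun h => ⟨k, hk, rfl, h⟩⟩
      rintro ⟨k', hk', he, h⟩
      have := hρ.1 (Finset.mem_coe.2 hk') (Finset.mem_coe.2 hk) (Prod.ext rfl he)
      obtain rfl : k' = k := congrArg Prod.snd this
      exact h
  · rw [hUS _ (by rw [symbols_ofArith]; exact Finset.empty_subset _), hS, hAM]

end TruthDef

namespace TruthDef

/-! ### Infima and suprema -/

theorem realize_sup_sentence {K : Type} (S : full.Structure K) (α β : full.Sentence) :
    @Sentence.Realize full K S (α ⊔ β) ↔
      @Sentence.Realize full K S α ∨ @Sentence.Realize full K S β :=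
  @BoundedFormula.realize_sup full K S _ _ _ _ _ _

theorem realize_inf_sentence {K : Type} (S : full.Structure K) (α β : full.Sentence) :
    @Sentence.Realize full K S (α ⊓ β) ↔
      @Sentence.Realize full K S α ∧ @Sentence.Realize full K S β :=
  @BoundedFormula.realize_inf full K S _ _ _ _ _ _

/-- A sentence as a formula with dummy free variables. -/
def dummy {α : Type} (σ : full.Sentence) : full.Formula α := σ.relabel Empty.elim

theorem symbols_dummy {α : Type} (σ : full.Sentence) :
    symbols (dummy σ : full.Formula α) = symbols σ :=
  symbols_relabel _ _

theorem realize_dummy {α K : Type} (S : full.Structure K) (σ : full.Sentence) (v : α → K) :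
    (dummy σ).Realize v ↔ @Sentence.Realize full K S σ := by
  rw [dummy, Formula.realize_relabel, Sentence.Realize]
  exact iff_of_eq (congrArg _ (Subsingleton.elim _ _))

/-- Definition by cases: `φ` if `σ` holds, and `ψ` otherwise. -/
def caseFormula {α : Type} (σ : full.Sentence) (φ ψ : full.Formula α) : full.Formula α :=
  (dummy σ ⊓ φ) ⊔ ((dummy σ).not ⊓ ψ)

theorem symbols_caseFormula {α : Type} (σ : full.Sentence) (φ ψ : full.Formula α) :
    symbols (caseFormula σ φ ψ) = symbols σ ∪ symbols φ ∪ symbols ψ := by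
  have : symbols (dummy σ : full.Formula α).not = symbols σ :=
    (symbols_not _).trans (symbols_dummy σ)
  rw [caseFormula, symbols_sup, symbols_inf, symbols_inf, symbols_dummy, this]
  ext; simp only [Finset.mem_union]; tauto

theorem realize_caseFormula_pos {α K : Type} (S : full.Structure K) {σ : full.Sentence}
    (φ ψ : full.Formula α) (h : @Sentence.Realize full K S σ) (v : α → K) :
    (caseFormula σ φ ψ).Realize v ↔ φ.Realize v := by
  rw [caseFormula, Formula.realize_sup, Formula.realize_inf, Formula.realize_inf, Formula.realize_not,
    realize_dummy]
  tauto

theorem realize_caseFormula_neg {α K : Type} (S : full.Structure K) {σ : full.Sentence}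
    (φ ψ : full.Formula α) (h : ¬ @Sentence.Realize full K S σ) (v : α → K) :
    (caseFormula σ φ ψ).Realize v ↔ ψ.Realize v := by
  rw [caseFormula, Formula.realize_sup, Formula.realize_inf, Formula.realize_inf, Formula.realize_not,
    realize_dummy]
  tauto

/-- `s` applied if `σ` holds, and `r` otherwise. -/
def casesTranslation (σ : full.Sentence) (s r : Translation) : Translation :=
  fun n k => caseFormula σ (s n k) (r n k)

theorem reinterpret_casesTranslation_pos {K : Type} (S : full.Structure K) {σ : full.Sentence}
    (s r : Translation) (h : @Sentence.Realize full K S σ) :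
    reinterpret (casesTranslation σ s r) S = reinterpret s S := by
  refine Structure.ext rfl ?_
  funext n R v
  cases R with
  | inl R => rfl
  | inr k => exact propext (realize_caseFormula_pos S _ _ h v)

theorem reinterpret_casesTranslation_neg {K : Type} (S : full.Structure K) {σ : full.Sentence}
    (s r : Translation) (h : ¬ @Sentence.Realize full K S σ) :
    reinterpret (casesTranslation σ s r) S = reinterpret r S := by
  refine Structure.ext rfl ?_
  funext n R v
  cases R with
  | inl R => rfl
  | inr k => exact propext (realize_caseFormula_neg S _ _ h v)

/-! ### Closure of conservative truth definitions under the two operations -/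

theorem isTheoryOfTruth_singleton_iff {α : full.Sentence} :
    IsTheoryOfTruth {α} ↔
      (∃ (K : Type) (S : full.Structure K), Nonempty K ∧ @Sentence.Realize full K S α) ∧
      (∀ φ ∈ EA, ∀ (K : Type) (S : full.Structure K), Nonempty K →
        @Sentence.Realize full K S α → @Sentence.Realize full K S (ofArith φ)) ∧
      ∃ Θ : full.Formula (Fin 1), symbols Θ ⊆ symbols α ∧
        ∀ (σ : arith.Sentence) (K : Type) (S : full.Structure K), Nonempty K →
          @Sentence.Realize full K S α →
          ((Θ.Realize fun _ =>
            ((LHom.sumInl : arith →ᴸ full).onTerm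
              (numeral (code σ) : arith.Term (Empty ⊕ Fin 0))).realize
                (Sum.elim (default : Empty → K) default)) ↔
            @Sentence.Realize full K S (ofArith σ)) := by
  unfold IsTheoryOfTruth
  simp only [singleton_isSatisfiable_iff, signature_singleton, singleton_models_iff,
    Finset.coe_subset]
  refine and_congr Iff.rfl (and_congr Iff.rfl (exists_congr fun Θ => and_congr Iff.rfl
    (forall_congr' fun σ => forall_congr' fun K => forall_congr' fun S => forall_congr' fun _ =>
      forall_congr' fun _ => ?_)))
  refine BoundedFormula.realize_iff.trans (iff_congr ?_ Iff.rfl)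
  exact realize_inst _ _ _ _

/-- The truth formula is that of `α` where `α` holds and that of `β` elsewhere. Conservativity
passes down from `α`, which is the stronger sentence. -/
theorem IsConservativeTruthDefinition.sup {α β : full.Sentence}
    (hα : IsConservativeTruthDefinition α) (hβ : IsConservativeTruthDefinition β) :
    IsConservativeTruthDefinition (α ⊔ β) := by
  obtain ⟨⟨K, S, hK, hS⟩, hEα, Θ, hΘ, hΘα⟩ := isTheoryOfTruth_singleton_iff.1 hα.1
  obtain ⟨-, hEβ, Ξ, hΞ, hΞβ⟩ := isTheoryOfTruth_singleton_iff.1 hβ.1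
  refine ⟨isTheoryOfTruth_singleton_iff.2 ⟨⟨K, S, hK, (realize_sup_sentence S α β).2 (.inl hS)⟩,
    fun φ hφ K S hK h => ?_, caseFormula α Θ Ξ, ?_, fun σ K S hK h => ?_⟩, fun σ hσ => hα.2 σ ?_⟩
  · rcases (realize_sup_sentence S α β).1 h with h | h
    · exact hEα φ hφ K S hK h
    · exact hEβ φ hφ K S hK h
  · rw [symbols_caseFormula, symbols_sup]
    exact Finset.union_subset (Finset.union_subset Finset.subset_union_left
      (hΘ.trans Finset.subset_union_left)) (hΞ.trans Finset.subset_union_right)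
  · by_cases hS : @Sentence.Realize full K S α
    · exact (realize_caseFormula_pos S Θ Ξ hS _).trans (hΘα σ K S hK hS)
    · exact (realize_caseFormula_neg S Θ Ξ hS _).trans
        (hΞβ σ K S hK (((realize_sup_sentence S α β).1 h).resolve_left hS))
  · rw [singleton_models_iff] at hσ ⊢
    exact fun K S hK h => hσ K S hK ((realize_sup_sentence S α β).2 (.inl h))

theorem IsConservativeTruthDefinition.models_EA {α : full.Sentence}
    (hα : IsConservativeTruthDefinition α) :
    ∃ (K : Type) (_ : arith.Structure K), Nonempty K ∧ K ⊨ EA := by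
  obtain ⟨⟨K, S, hK, hS⟩, hE, -⟩ := isTheoryOfTruth_singleton_iff.1 hα.1
  let := (LHom.sumInl : arith →ᴸ full).reduct K
  refine ⟨K, this, hK, (Theory.model_iff _).2 fun φ hφ => ?_⟩
  exact (LHom.realize_onSentence K (LHom.sumInl : arith →ᴸ full) φ).1 (hE φ hφ K S hK hS)

/-- The truth formula of `α` still works. Consistency and conservativity both come from
`exists_model_inf_rename`: an arithmetical consequence of the conjunction holds in every model of
`EA`. -/
theorem IsConservativeTruthDefinition.inf_rename {α β : full.Sentence}
    (hα : IsConservativeTruthDefinition α) (hβ : IsConservativeTruthDefinition β)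
    {ρ : ℕ → ℕ → ℕ} (hρ : RenamesApart ρ α β) :
    IsConservativeTruthDefinition (α ⊓ (renameBy ρ).apply β) := by
  obtain ⟨M, hM, hne, hEA⟩ := hα.models_EA
  obtain ⟨K, S, hK, hS, -⟩ := exists_model_inf_rename hα.2 hβ.2 hρ M hEA
  obtain ⟨-, hE, Θ, hΘ, hΘα⟩ := isTheoryOfTruth_singleton_iff.1 hα.1
  refine ⟨isTheoryOfTruth_singleton_iff.2 ⟨⟨K, S, hK, hS⟩,
    fun φ hφ K S hK h => hE φ hφ K S hK ((realize_inf_sentence S _ _).1 h).1, Θ, ?_,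
    fun σ K S hK h => hΘα σ K S hK ((realize_inf_sentence S _ _).1 h).1⟩, fun σ hσ => ?_⟩
  · rw [symbols_inf]
    exact hΘ.trans Finset.subset_union_left
  · rw [Theory.models_sentence_iff]
    intro M
    obtain ⟨K, S, hK, hS, hKM⟩ := exists_model_inf_rename hα.2 hβ.2 hρ M M.is_model
    exact (hKM σ).1 (singleton_models_iff.1 hσ K S hK hS)

/-! ### Bounds in the definability preorder -/

theorem definable_sup_comm {α β : full.Sentence} : Definable {α ⊔ β} {β ⊔ α} :=
  definable_of_imp (by rw [symbols_sup, symbols_sup, Finset.union_comm]) fun K S _ h =>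
    (realize_sup_sentence S _ _).2 ((realize_sup_sentence S _ _).1 h).symm

/-- Symbols foreign to `α` must be given formulas in its language. Any will do, here `⊥`, since the
disjunct `α` is true whatever they mean. -/
theorem definable_sup_left (α β : full.Sentence) : Definable {α ⊔ β} {α} := by
  classical
  let s : Translation := fun n k =>
    if (n, k) ∈ symbols α then renameBy (fun _ k => k) n k else ⊥
  refine definable_singleton_iff.2 ⟨s, ?_, ?_⟩
  · intro n k _
    simp only [s]
    split_ifs with h
    · exact Finset.singleton_subset_iff.2 h
    · exact Finset.empty_subset _
  · intro K S hK h
    refine (realize_sup_sentence _ _ _).2 (.inl ?_)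
    refine (realize_congr_symbols (reinterpret s S) S α (fun _ _ => rfl) (fun _ _ => rfl) ?_ _ _).2 h
    intro l k hk
    funext v
    refine propext ?_
    change Formula.Realize (ite _ _ _) v ↔ _
    rw [if_pos hk]
    exact Formula.realize_rel (L := full) (R := Sum.inr k)

theorem definable_sup {α β γ : full.Sentence} (hα : Definable {γ} {α}) (hβ : Definable {γ} {β}) :
    Definable {γ} {α ⊔ β} := by
  obtain ⟨s, hs, hsγ⟩ := definable_singleton_iff.1 hα
  obtain ⟨r, hr, hrγ⟩ := definable_singleton_iff.1 hβ
  refine definable_singleton_iff.2 ⟨casesTranslation α s r, fun n k h => ?_, fun K S hK h => ?_⟩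
  · rw [casesTranslation, symbols_caseFormula, symbols_sup]
    exact Finset.union_subset (Finset.union_subset Finset.subset_union_left
      ((hs n k h).trans Finset.subset_union_left)) ((hr n k h).trans Finset.subset_union_right)
  · by_cases hS : @Sentence.Realize full K S α
    · rw [reinterpret_casesTranslation_pos S s r hS]
      exact hsγ K S hK hS
    · rw [reinterpret_casesTranslation_neg S s r hS]
      exact hrγ K S hK (((realize_sup_sentence S α β).1 h).resolve_left hS)

theorem definable_inf_rename_left (α β : full.Sentence) (ρ : ℕ → ℕ → ℕ) :
    Definable {α} {α ⊓ (renameBy ρ).apply β} :=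
  definable_of_imp (by rw [symbols_inf]; exact Finset.subset_union_left) fun K S _ h =>
    ((realize_inf_sentence S _ _).1 h).1

theorem definable_inf_rename_right (α β : full.Sentence) (ρ : ℕ → ℕ → ℕ) :
    Definable {β} {α ⊓ (renameBy ρ).apply β} := by
  refine definable_singleton_iff.2 ⟨renameBy ρ, fun n k h => ?_, fun K S hK h => ?_⟩
  · rw [symbols_renameBy, symbols_inf, symbols_apply_renameBy, Finset.singleton_subset_iff]
    exact Finset.mem_union_right _ (Finset.mem_image.2 ⟨(n, k), h, rfl⟩)
  · exact (realize_apply _ S β _ _).1 ((realize_inf_sentence S _ _).1 h).2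

/-- The two translations are glued: symbols of `α` follow the first, and a renamed symbol `ρ l k`
follows the second at `k`. -/
theorem inf_rename_definable {α β γ : full.Sentence} {ρ : ℕ → ℕ → ℕ} (hρ : RenamesApart ρ α β)
    (hα : Definable {α} {γ}) (hβ : Definable {β} {γ}) :
    Definable {α ⊓ (renameBy ρ).apply β} {γ} := by
  classical
  obtain ⟨s, hs, hsγ⟩ := definable_singleton_iff.1 hα
  obtain ⟨r, hr, hrγ⟩ := definable_singleton_iff.1 hβ
  let t : Translation := fun l m => if (l, m) ∈ symbols α then s l m else
    if h : ∃ k, (l, k) ∈ symbols β ∧ ρ l k = m then r l h.choose else ⊥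
  have htα : ∀ l m, (l, m) ∈ symbols α → t l m = s l m := fun l m h => if_pos h
  have htβ : ∀ l k, (l, k) ∈ symbols β → t l (ρ l k) = r l k := by
    intro l k hk
    have h : ∃ k', (l, k') ∈ symbols β ∧ ρ l k' = ρ l k := ⟨k, hk, rfl⟩
    have hc : h.choose = k := congrArg Prod.snd
      (hρ.1 (Finset.mem_coe.2 h.choose_spec.1) (Finset.mem_coe.2 hk)
        (Prod.ext rfl h.choose_spec.2))
    simp only [t]
    rw [if_neg (hρ.2 _ hk), dif_pos h, hc]
  refine definable_singleton_iff.2 ⟨t, fun n m h => ?_, fun K S hK h => ?_⟩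
  · rw [symbols_inf, symbols_apply_renameBy, Finset.mem_union, Finset.mem_image] at h
    rcases h with h | ⟨⟨n', k⟩, hk, he⟩
    · rw [htα n m h]
      exact hs n m h
    · obtain ⟨rfl, rfl⟩ := Prod.mk.inj he
      rw [htβ _ _ hk]
      exact hr _ _ hk
  · refine (realize_inf_sentence _ _ _).2 ⟨?_, (realize_apply _ _ β _ _).2 ?_⟩
    · refine (realize_congr_symbols (reinterpret t S) (reinterpret s S) α (fun _ _ => rfl)
        (fun _ _ => rfl) ?_ _ _).2 (hsγ K S hK h)
      intro l k hk
      funext v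
      exact congrArg (fun φ : full.Formula (Fin l) => φ.Realize v) (htα l k hk)
    · refine (realize_congr_symbols (reinterpret (renameBy ρ) (reinterpret t S))
        (reinterpret r S) β (fun _ _ => rfl) (fun _ _ => rfl) ?_ _ _).2 (hrγ K S hK h)
      intro l k hk
      funext v
      refine (propext (@Formula.realize_rel full K (reinterpret t S) _ _ _ _ _)).trans ?_
      exact congrArg (fun φ : full.Formula (Fin l) => φ.Realize v) (htβ l k hk)

/-- Shifting every index past the largest one in `α` is injective on all symbols and avoids `α`,
whatever `β` is. -/
theorem exists_renamesApart (α : full.Sentence) :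
    ∃ ρ : ℕ → ℕ → ℕ, ∀ β : full.Sentence, RenamesApart ρ α β := by
  refine ⟨fun _ k => k + ((symbols α).sup Prod.snd + 1), fun β => ⟨?_, ?_⟩⟩
  · rintro ⟨n, k⟩ - ⟨n', k'⟩ - h
    simpa using h
  · intro P _ h
    have := Finset.le_sup (f := Prod.snd) h
    simp only at this
    lia

/-! ### The lattice -/

theorem cls_le_cls_iff {α β : full.Sentence} (hα : IsConservativeTruthDefinition α)
    (hβ : IsConservativeTruthDefinition β) : cls α hα ≤ cls β hβ ↔ Definable {α} {β} :=
  Iff.rfl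

theorem exists_cls (x : DefinabilityOrder) :
    ∃ (α : full.Sentence) (hα : IsConservativeTruthDefinition α), cls α hα = x := by
  obtain ⟨⟨α, hα⟩, rfl⟩ := Quotient.exists_rep x
  exact ⟨α, hα, rfl⟩

theorem isGLB_cls_sup {α β : full.Sentence} (hα : IsConservativeTruthDefinition α)
    (hβ : IsConservativeTruthDefinition β) :
    IsGLB {cls α hα, cls β hβ} (cls (α ⊔ β) (hα.sup hβ)) := by
  refine ⟨?_, fun x hx => ?_⟩
  · rintro _ (rfl | rfl)
    · exact (cls_le_cls_iff _ _).2 (definable_sup_left α β)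
    · exact (cls_le_cls_iff _ _).2 (definable_sup_comm.trans (definable_sup_left β α))
  · obtain ⟨γ, hγ, rfl⟩ := exists_cls x
    exact (cls_le_cls_iff _ _).2 (definable_sup ((cls_le_cls_iff _ _).1 (hx (.inl rfl)))
      ((cls_le_cls_iff _ _).1 (hx (.inr rfl))))

theorem isLUB_cls_inf_rename {α β : full.Sentence} (hα : IsConservativeTruthDefinition α)
    (hβ : IsConservativeTruthDefinition β) {ρ : ℕ → ℕ → ℕ} (hρ : RenamesApart ρ α β) :
    IsLUB {cls α hα, cls β hβ} (cls (α ⊓ (renameBy ρ).apply β) (hα.inf_rename hβ hρ)) := by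
  refine ⟨?_, fun x hx => ?_⟩
  · rintro _ (rfl | rfl)
    · exact (cls_le_cls_iff _ _).2 (definable_inf_rename_left α β ρ)
    · exact (cls_le_cls_iff _ _).2 (definable_inf_rename_right α β ρ)
  · obtain ⟨γ, hγ, rfl⟩ := exists_cls x
    exact (cls_le_cls_iff _ _).2 (inf_rename_definable hρ
      ((cls_le_cls_iff _ _).1 (hx (.inl rfl))) ((cls_le_cls_iff _ _).1 (hx (.inr rfl))))

theorem exists_isGLB (x y : DefinabilityOrder) : ∃ z, IsGLB {x, y} z := by
  obtain ⟨α, hα, rfl⟩ := exists_cls x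
  obtain ⟨β, hβ, rfl⟩ := exists_cls y
  exact ⟨_, isGLB_cls_sup hα hβ⟩

theorem exists_isLUB (x y : DefinabilityOrder) : ∃ z, IsLUB {x, y} z := by
  obtain ⟨α, hα, rfl⟩ := exists_cls x
  obtain ⟨β, hβ, rfl⟩ := exists_cls y
  obtain ⟨ρ, hρ⟩ := exists_renamesApart α
  exact ⟨_, isLUB_cls_inf_rename hα hβ (hρ β)⟩

noncomputable instance : Lattice DefinabilityOrder where
  inf x y := (exists_isGLB x y).choose
  sup x y := (exists_isLUB x y).choose
  inf_le_left x y := (exists_isGLB x y).choose_spec.1 (.inl rfl)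
  inf_le_right x y := (exists_isGLB x y).choose_spec.1 (.inr rfl)
  le_inf x y z h₁ h₂ := (exists_isGLB y z).choose_spec.2 (by rintro _ (rfl | rfl) <;> assumption)
  le_sup_left x y := (exists_isLUB x y).choose_spec.1 (.inl rfl)
  le_sup_right x y := (exists_isLUB x y).choose_spec.1 (.inr rfl)
  sup_le x y z h₁ h₂ := (exists_isLUB x y).choose_spec.2 (by rintro _ (rfl | rfl) <;> assumption)

theorem cls_inf_cls {α β : full.Sentence} (hα : IsConservativeTruthDefinition α)
    (hβ : IsConservativeTruthDefinition β) :
    cls α hα ⊓ cls β hβ = cls (α ⊔ β) (hα.sup hβ) :=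
  isGLB_pair.unique (isGLB_cls_sup hα hβ)

theorem cls_sup_cls {α β : full.Sentence} (hα : IsConservativeTruthDefinition α)
    (hβ : IsConservativeTruthDefinition β) {ρ : ℕ → ℕ → ℕ} (hρ : RenamesApart ρ α β) :
    cls α hα ⊔ cls β hβ = cls (α ⊓ (renameBy ρ).apply β) (hα.inf_rename hβ hρ) :=
  isLUB_pair.unique (isLUB_cls_inf_rename hα hβ hρ)

noncomputable instance : DistribLattice DefinabilityOrder where
  le_sup_inf x y z := by
    obtain ⟨α, hα, rfl⟩ := exists_cls x
    obtain ⟨β, hβ, rfl⟩ := exists_cls y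
    obtain ⟨γ, hγ, rfl⟩ := exists_cls z
    -- One renaming for `β`, `γ` and `β ⊔ γ` reduces the inequality to distributing conjunction over
    -- disjunction, as renaming commutes with `⊔`.
    obtain ⟨ρ, hρ⟩ := exists_renamesApart α
    rw [cls_sup_cls hα hβ (hρ β), cls_sup_cls hα hγ (hρ γ), cls_inf_cls, cls_inf_cls,
      cls_sup_cls hα (hβ.sup hγ) (hρ _), cls_le_cls_iff]
    refine definable_of_imp ?_ fun K S _ h => ?_
    · simp only [symbols_sup, symbols_inf, symbols_apply_renameBy, Finset.image_union]
      intro P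
      simp only [Finset.mem_union]
      tauto
    · have happly : (renameBy ρ).apply (β ⊔ γ) =
          ((renameBy ρ).apply β ⊔ (renameBy ρ).apply γ : full.Sentence) := rfl
      rw [happly] at h
      simp only [realize_sup_sentence, realize_inf_sentence] at h ⊢
      tauto

end TruthDef
theorem mainTheorem2 :
    ∃ D : DistribLattice TruthDef.DefinabilityOrder,
      D.toPartialOrder = (inferInstance : PartialOrder TruthDef.DefinabilityOrder) ∧
      (∀ (α β : FirstOrder.Language.Sentence TruthDef.full)
        (hα : TruthDef.IsConservativeTruthDefinition α)
        (hβ : TruthDef.IsConservativeTruthDefinition β),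
        ∃ h : TruthDef.IsConservativeTruthDefinition (α ⊔ β),
          D.inf (TruthDef.cls α hα) (TruthDef.cls β hβ) = TruthDef.cls (α ⊔ β) h) ∧
      (∀ α : FirstOrder.Language.Sentence TruthDef.full,
        ∃ ρ : ℕ → ℕ → ℕ, ∀ β : FirstOrder.Language.Sentence TruthDef.full,
          TruthDef.RenamesApart ρ α β) ∧
      (∀ (α β : FirstOrder.Language.Sentence TruthDef.full)
        (hα : TruthDef.IsConservativeTruthDefinition α)
        (hβ : TruthDef.IsConservativeTruthDefinition β)
        (ρ : ℕ → ℕ → ℕ), TruthDef.RenamesApart ρ α β →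
        ∃ h : TruthDef.IsConservativeTruthDefinition
            (α ⊓ (TruthDef.renameBy ρ).apply β),
          D.sup (TruthDef.cls α hα) (TruthDef.cls β hβ) =
            TruthDef.cls (α ⊓ (TruthDef.renameBy ρ).apply β) h) :=
  ⟨inferInstance, rfl, fun _ _ hα hβ => ⟨hα.sup hβ, TruthDef.cls_inf_cls hα hβ⟩,
    TruthDef.exists_renamesApart,
    fun _ _ hα hβ _ hρ => ⟨hα.inf_rename hβ hρ, TruthDef.cls_sup_cls hα hβ hρ⟩⟩
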